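/- **Coverage game.** Let $\mathcal Q\subset\mathbb Z^2$ be a finite set (the centres of the unit squares of a discretized mission space) such that the location graph on $\mathcal Q$, in which $q\ne q'$ are adjacent iff $|q_x-q'_x|+|q_y-q'_y|=1$, is connected; let $D$ be its diameter. Let $W_q\ge 0$ for $q\in\mathcal Q$, let $N\ge 1$ and $V=\{1,\dots,N\}$, and let $\mathcal C\subset[0,\mathrm{FL}_{\max}]\times[0,2\pi)$ be a finite nonempty set of camera control vectors $c=(\mathrm{FL},\theta)$; assume $|\mathcal Q|\,|\mathcal C|\ge 2$. An action of agent $i$ is $s_i=(a_i,c_i)\in\mathcal Q\times\mathcal C$, and $\mathcal A=(\mathcal Q\times\mathcal C)^N$. The angle of view $\alpha_i\in[\alpha_{\min},\alpha_{\max}]$ and the ranges $r_i^{\rm shrt},r_i^{\rm lng}\in[r_{\min},r_{\max}]$ of agent $i$ are functions of its focal length $\mathrm{FL}_i$, and its sensor footprint is the annulus sector $$\mathcal D_i(a_i,c_i)=\{a_i+r(\cos\varphi,\sin\varphi)\;:\;r\ge 0,\ r_i^{\rm shrt}\le r\le r_i^{\rm lng},\ |\varphi-\theta_i|\le\alpha_i/2\}.$$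 With $n_q(s)=|\{k\in V: q\in\mathcal D_k(a_k,c_k)\}|$, the utilities are $$u_i(s)=\sum_{q\in\mathcal D_i(a_i,c_i)\cap\mathcal Q}\frac{W_q}{n_q(s)}-\tfrac12\alpha_i\big((r_i^{\rm lng})^2-(r_i^{\rm shrt})^2\big),$$ and the feasible actions of an agent located at $a$ are $\mathcal F(a)=(\{a\}\cup\{\text{neighbours of }a\})\times\mathcal C$. Let $\mathcal E(\Gamma_{\rm cov})$ be the set of constrained Nash equilibria, i.e. of all $s\in\mathcal A$ with $u_i(s)\ge u_i(x,s_{-i})$ for all $i\in V$ and all $x\in\mathcal F(a_i)$, and let $\operatorname{diag}\mathcal E(\Gamma_{\rm cov})=\{(s,s):s\in\mathcal E(\Gamma_{\rm cov})\}$. **DISCL algorithm.** The action $s(0)$ is uniformly distributed on $\mathcal A$, and $s(0)=s(1)=s(2)$. For $t\ge 2$ put $\epsilon(t)=t^{-1/(N(D+1))}$, and let $s_i(\tau_i(t))$ be $s_i(t)$ if $u_i(s(t))\ge u_i(s(t-1))$ and $s_i(t-1)$ otherwise. Given $s(0),\dots,s(t)$, the agents choose $s_1(t+1),\dots,s_N(t+1)$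 independently: with probability $1-\epsilon(t)$ agent $i$ takes $s_i(t+1)=s_i(\tau_i(t))$, and with probability $\epsilon(t)$ it takes $s_i(t+1)$ uniformly from $\mathcal F(a_i(t))\setminus\{s_i(\tau_i(t))\}$. **Theorem.** The time-inhomogeneous Markov chain $z(t)=(s(t-1),s(t))$ satisfies $$\lim_{t\to\infty}\mathbb P\big(z(t)\in\operatorname{diag}\mathcal E(\Gamma_{\rm cov})\big)=1 .$$ In particular $\lim_{t\to\infty}\mathbb P\big(s(t)\in\mathcal E(\Gamma_{\rm cov})\big)=1$, so the play converges in probability to the set of constrained Nash equilibria. -/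

import Mathlib

open MeasureTheory Filter Topology

namespace Coverage

/-- A constrained (pure) Nash equilibrium of a constrained strategic game with players `ι`, action
sets `A i`, utilities `u i` and feasible action sets `F i s`: no player can gain by a unilateral
deviation to an action that is feasible at `s`. -/
def IsConstrainedNash {ι : Type*} [DecidableEq ι] {A : ι → Type*}
    (u : ι → (∀ i, A i) → ℝ) (F : ∀ i, (∀ j, A j) → Set (A i)) (s : ∀ i, A i) : Prop :=
  ∀ i, ∀ x ∈ F i s, u i (Function.update s i x) ≤ u i s

/-- The location graph on a finite set `Q` of lattice squares (labelled by their centres): two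
squares are adjacent iff `|q_x - q'_x| + |q_y - q'_y| = 1`. -/
def locGraph (Q : Finset (ℤ × ℤ)) : SimpleGraph Q where
  Adj q q' := |q.1.1 - q'.1.1| + |q.1.2 - q'.1.2| = 1
  symm := ⟨fun q q' h => by
    rw [abs_sub_comm q'.1.1, abs_sub_comm q'.1.2]; exact h⟩
  loopless := ⟨fun q h => by simp at h⟩

/-- The annulus sector with apex `a`, central direction `θ`, opening angle `α`, and radii between
`r₁` and `r₂`. -/
def annulusSector (a : ℝ × ℝ) (θ α r₁ r₂ : ℝ) : Set (ℝ × ℝ) :=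
  {p | ∃ r φ : ℝ, 0 ≤ r ∧ r₁ ≤ r ∧ r ≤ r₂ ∧ |φ - θ| ≤ α / 2 ∧
    p = (a.1 + r * Real.cos φ, a.2 + r * Real.sin φ)}

/-- The data of the coverage problem. -/
structure Model where
  /-- number of agents -/
  N : ℕ
  N_pos : 0 < N
  /-- the mission space: the centres of the squares -/
  Q : Finset (ℤ × ℤ)
  connected : (locGraph Q).Connected
  /-- the benefit of observing a square -/
  W : Q → ℝ
  W_nonneg : ∀ q, 0 ≤ W q
  /-- maximal focal length -/
  FLmax : ℝ
  /-- the camera control vectors `(FL, θ)` (focal length, orientation) that can be chosen -/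
  C : Finset (ℝ × ℝ)
  C_nonempty : C.Nonempty
  C_subset : (C : Set (ℝ × ℝ)) ⊆ Set.Icc 0 FLmax ×ˢ Set.Ico 0 (2 * Real.pi)
  alphaMin : ℝ
  alphaMax : ℝ
  rMin : ℝ
  rMax : ℝ
  /-- the angle of view of each agent's camera, as a function of the focal length -/
  alpha : Fin N → ℝ → ℝ
  /-- the shortest range of each agent's camera, as a function of the focal length -/
  rShrt : Fin N → ℝ → ℝ
  /-- the longest range of each agent's camera, as a function of the focal length -/
  rLng : Fin N → ℝ → ℝ
  alpha_mem : ∀ i, ∀ l ∈ Set.Icc 0 FLmax, alpha i l ∈ Set.Icc alphaMin alphaMax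
  rShrt_mem : ∀ i, ∀ l ∈ Set.Icc 0 FLmax, rShrt i l ∈ Set.Icc rMin rMax
  rLng_mem : ∀ i, ∀ l ∈ Set.Icc 0 FLmax, rLng i l ∈ Set.Icc rMin rMax

namespace Model

variable (M : Model)

/-- The diameter `D` of the location graph. -/
noncomputable def D : ℕ := (locGraph M.Q).diam

/-- An action of one agent: a position in `Q` and a camera control vector in `C`. -/
abbrev Action : Type := M.Q × M.C

/-- A multi-agent action. -/
abbrev Profile : Type := Fin M.N → M.Action

/-- The visual sensor footprint of agent `i` under the action `x`. -/
def footprint (i : Fin M.N) (x : M.Action) : Set (ℝ × ℝ) :=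
  annulusSector ((x.1.1.1 : ℝ), (x.1.1.2 : ℝ)) x.2.1.2
    (M.alpha i x.2.1.1) (M.rShrt i x.2.1.1) (M.rLng i x.2.1.1)

/-- The square `q` is observed by agent `i` under the action `x`. -/
def Sees (i : Fin M.N) (x : M.Action) (q : M.Q) : Prop :=
  ((q.1.1 : ℝ), (q.1.2 : ℝ)) ∈ M.footprint i x

open scoped Classical in
/-- `n_q(s)`, the number of agents that observe `q`. -/
noncomputable def numSees (s : M.Profile) (q : M.Q) : ℕ :=
  (Finset.univ.filter fun k => M.Sees k (s k) q).card

/-- The energy cost `f_i(c) = α_i ((r_i^lng)² - (r_i^shrt)²) / 2`. -/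
noncomputable def cost (i : Fin M.N) (c : M.C) : ℝ :=
  1 / 2 * M.alpha i c.1.1 * ((M.rLng i c.1.1) ^ 2 - (M.rShrt i c.1.1) ^ 2)

open scoped Classical in
/-- The utility of agent `i`. -/
noncomputable def utility (i : Fin M.N) (s : M.Profile) : ℝ :=
  (∑ q ∈ Finset.univ.filter fun q => M.Sees i (s i) q, M.W q / (M.numSees s q : ℝ))
    - M.cost i (s i).2

open scoped Classical in
/-- The feasible actions `({a} ∪ N_a) × C` of an agent located at `a`. -/
noncomputable def feasible (a : M.Q) : Finset M.Action :=
  Finset.univ.filter fun x => x.1 = a ∨ (locGraph M.Q).Adj a x.1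

/-- The set of constrained Nash equilibria of the coverage game. -/
def equilibria : Set M.Profile :=
  {s | IsConstrainedNash M.utility (fun i s => (M.feasible (s i).1 : Set M.Action)) s}

/-- `{(s, s) | s is a constrained Nash equilibrium}`. -/
def diagEquilibria : Set (M.Profile × M.Profile) :=
  {z | ∃ s ∈ M.equilibria, z = (s, s)}

/-- The exploration rate `ε(t) = t ^ (-1 / (N (D + 1)))`. -/
noncomputable def rate (t : ℕ) : ℝ :=
  (t : ℝ) ^ (-(1 / ((M.N : ℝ) * ((M.D : ℝ) + 1))))

open scoped Classical in
/-- The more successful of the last two actions of agent `i`, where `x = s(t-1)` and `y = s(t)`;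
ties are resolved in favour of the most recent action. -/
noncomputable def moreSuccessful (x y : M.Profile) (i : Fin M.N) : M.Action :=
  if M.utility i x ≤ M.utility i y then y i else x i

open scoped Classical in
/-- The probability that agent `i`, with exploration rate `e`, chooses the action `w` after
`x = s(t-1)` and `y = s(t)`: with probability `1 - e` it takes the more successful action, with
probability `e` it picks uniformly among the other feasible actions. -/
noncomputable def agentProb (e : ℝ) (x y : M.Profile) (i : Fin M.N) (w : M.Action) : ℝ :=
  let b := M.moreSuccessful x y i
  let S := (M.feasible (y i).1).erase b
  (1 - e) * (if w = b then 1 else 0) + e * (if w ∈ S then 1 / (S.card : ℝ) else 0)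

/-- The probability of moving from `(x, y)` to `(y, w)`: the agents act simultaneously and
independently. -/
noncomputable def stepProb (e : ℝ) (x y w : M.Profile) : ℝ :=
  ∏ i, M.agentProb e x y i (w i)

/-- `s 0, s 1, s 2, …` is the sequence of multi-agent actions played under the synchronous
learning algorithm: the initial action is uniform, it is kept until the updates begin at time
`2`, and at each time `t ≥ 2` the next action is drawn, given the whole past, according to
`stepProb` with exploration rate `ε(t)`. -/
structure IsDISCL {Ω : Type*} [MeasurableSpace Ω] (μ : Measure Ω) (s : ℕ → Ω → M.Profile) :
    Prop where
  measurable : ∀ t, Measurable (s t)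
  init : ∀ x, μ {ω | s 0 ω = x} = ((Fintype.card M.Profile : ℕ) : ENNReal)⁻¹
  keep_one : ∀ᵐ ω ∂μ, s 1 ω = s 0 ω
  keep_two : ∀ᵐ ω ∂μ, s 2 ω = s 1 ω
  update : ∀ t, 2 ≤ t → ∀ (h : ℕ → M.Profile) (w : M.Profile),
    μ {ω | (∀ k ≤ t, s k ω = h k) ∧ s (t + 1) ω = w} =
      μ {ω | ∀ k ≤ t, s k ω = h k} *
        ENNReal.ofReal (M.stepProb (M.rate t) (h (t - 1)) (h t) w)

end Model

end Coverage

namespace Coverage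

namespace Model

variable (M : Model)

/-! ### The potential function -/

/-! Sharing `W q` equally among its observers makes the game an exact potential game, with a
harmonic-sum potential. Without exploration, every pair of consecutive profiles settles within `2 *
M.N + 1` steps at a pair `(s, s)`, its rest point (`unrest_settle_lt`, `restPoint_settle`). From
`(s, s)`, a single explorer whose utility does not drop makes its deviation permanent, because ties
favour the newer action; otherwise the pair returns to `s`.

Call `s` stable if all chains of such weak improvements from `s` stay among equilibria. Maximising
the potential over reachable profiles shows that every profile reaches a stable one. An unstable
rest point therefore gets closer to stability at rate of order `ε`, while a stable one is left only
if two agents explore at once, at rate of order `ε ^ 2`.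

The Lyapunov function `1 - decay ^ stableDist` of the rest point turns this into the drift
inequality `sum_stepProb_mul_lyapunov_le`: contraction by `1 - drift * ε`, with error of order `ε *
(ε + unrest)`. The expected unrest tends to `0` because its own contraction rate is constant. As `ε`
tends to `0` and is not summable, the expected Lyapunov function tends to `0` too, and a Markov-type
bound concludes. -/

open scoped Classical in
/-- The number of agents other than `i` that observe `q`. -/
noncomputable def numSeesOthers (i : Fin M.N) (s : M.Profile) (q : M.Q) : ℕ :=
  ((Finset.univ.erase i).filter fun k => M.Sees k (s k) q).card

open scoped Classical in
theorem numSees_eq (i : Fin M.N) (s : M.Profile) (q : M.Q) :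
    M.numSees s q = M.numSeesOthers i s q + if M.Sees i (s i) q then 1 else 0 := by
  unfold numSees numSeesOthers
  rw [← Finset.insert_erase (Finset.mem_univ i), Finset.filter_insert]
  split_ifs with h
  · rw [Finset.card_insert_of_notMem (by simp)]
    simp
  · simp

theorem numSeesOthers_update (i : Fin M.N) (s : M.Profile) (x : M.Action) (q : M.Q) :
    M.numSeesOthers i (Function.update s i x) q = M.numSeesOthers i s q := by
  classical
  unfold numSeesOthers
  congr 1
  refine Finset.filter_congr fun k hk => ?_
  rw [Function.update_of_ne (Finset.ne_of_mem_erase hk)]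

/-- The potential of the coverage game. -/
noncomputable def potential (s : M.Profile) : ℝ :=
  (∑ q, M.W q * ∑ l ∈ Finset.range (M.numSees s q), 1 / ((l : ℝ) + 1)) - ∑ i, M.cost i (s i).2

/-- The share `W q / n_q` of an observer is the last term of the harmonic sum at `q`. The remainder
does not involve `s i`, which makes the potential exact. -/
theorem potential_eq (i : Fin M.N) (s : M.Profile) :
    M.potential s = M.utility i s +
      ((∑ q, M.W q * ∑ l ∈ Finset.range (M.numSeesOthers i s q), 1 / ((l : ℝ) + 1)) -
        ∑ j ∈ Finset.univ.erase i, M.cost j (s j).2) := by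
  classical
  have h : ∀ q, M.W q * ∑ l ∈ Finset.range (M.numSees s q), 1 / ((l : ℝ) + 1) =
      (if M.Sees i (s i) q then M.W q / (M.numSees s q : ℝ) else 0) +
        M.W q * ∑ l ∈ Finset.range (M.numSeesOthers i s q), 1 / ((l : ℝ) + 1) := by
    intro q
    rw [M.numSees_eq i s q]
    split_ifs with hq
    · rw [Finset.sum_range_succ]
      push_cast
      ring
    · simp
  unfold potential utility
  rw [Finset.sum_congr rfl fun q _ => h q, Finset.sum_add_distrib, Finset.sum_filter,
    ← Finset.add_sum_erase Finset.univ (fun j => M.cost j (s j).2) (Finset.mem_univ i)]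
  ring

/-- The coverage game is an exact potential game. -/
theorem utility_update_sub (i : Fin M.N) (s : M.Profile) (x : M.Action) :
    M.utility i (Function.update s i x) - M.utility i s =
      M.potential (Function.update s i x) - M.potential s := by
  have h : ∑ j ∈ Finset.univ.erase i, M.cost j (Function.update s i x j).2 =
      ∑ j ∈ Finset.univ.erase i, M.cost j (s j).2 :=
    Finset.sum_congr rfl fun j hj => by
      rw [Function.update_of_ne (Finset.ne_of_mem_erase hj)]
  rw [M.potential_eq i s, M.potential_eq i (Function.update s i x)]
  simp only [numSeesOthers_update, h]
  ring

/-! ### The dynamics without exploration -/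

/-- The joint action that the agents choose if nobody explores. -/
noncomputable def best (z : M.Profile × M.Profile) : M.Profile :=
  fun i => M.moreSuccessful z.1 z.2 i

/-- One step of the dynamics without exploration. -/
noncomputable def settle (z : M.Profile × M.Profile) : M.Profile × M.Profile :=
  (z.2, M.best z)

open scoped Classical in
/-- The agents whose last two actions differ. -/
noncomputable def movers (z : M.Profile × M.Profile) : Finset (Fin M.N) :=
  Finset.univ.filter fun i => z.1 i ≠ z.2 i

open scoped Classical in
/-- A quantity that decreases along the dynamics without exploration. -/
noncomputable def unrest (z : M.Profile × M.Profile) : ℕ :=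
  2 * (M.movers z).card + if ∃ i ∈ M.movers z, M.utility i z.2 < M.utility i z.1 then 1 else 0

variable {M}

theorem mem_movers {z : M.Profile × M.Profile} {i : Fin M.N} :
    i ∈ M.movers z ↔ z.1 i ≠ z.2 i := by
  simp [movers]

theorem movers_eq_empty {z : M.Profile × M.Profile} : M.movers z = ∅ ↔ z.1 = z.2 := by
  rw [Finset.eq_empty_iff_forall_notMem, funext_iff]
  simp [mem_movers]

theorem unrest_eq_zero {z : M.Profile × M.Profile} : M.unrest z = 0 ↔ z.1 = z.2 := by
  rw [← movers_eq_empty]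
  constructor
  · intro h
    have : (M.movers z).card = 0 := by unfold unrest at h; omega
    exact Finset.card_eq_zero.mp this
  · intro h
    simp [unrest, h]

theorem unrest_le (z : M.Profile × M.Profile) : M.unrest z ≤ 2 * M.N + 1 := by
  have h := (M.movers z).card_le_univ
  rw [Fintype.card_fin] at h
  unfold unrest
  split_ifs <;> omega

/-- An agent that prefers its newer action repeats it; only agents that fall back on a different
older action keep moving. -/
theorem mem_movers_settle {z : M.Profile × M.Profile} {i : Fin M.N} :
    i ∈ M.movers (M.settle z) ↔ i ∈ M.movers z ∧ M.utility i z.2 < M.utility i z.1 := by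
  simp only [mem_movers, settle, best, moreSuccessful]
  split_ifs with h
  · simp [h]
  · simp [not_le.mp h, eq_comm]

/-- If a mover drops out, the weight `2` outweighs a possible rise of the indicator. If none does,
all movers revert, the pair is swapped, and the indicator falls from `1` to `0`. -/
theorem unrest_settle_lt {z : M.Profile × M.Profile} (hz : z.1 ≠ z.2) :
    M.unrest (M.settle z) < M.unrest z := by
  have hsub : M.movers (M.settle z) ⊆ M.movers z := fun i hi => (mem_movers_settle.mp hi).1
  rcases hsub.eq_or_ssubset with heq | hlt
  · have hall : ∀ i ∈ M.movers z, M.utility i z.2 < M.utility i z.1 := fun i hi =>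
      (mem_movers_settle.mp (heq ▸ hi)).2
    obtain ⟨i, hi⟩ := Finset.nonempty_iff_ne_empty.mpr (mt movers_eq_empty.mp hz)
    have hbest : M.best z = z.1 := by
      funext j
      unfold best moreSuccessful
      split_ifs with hj
      · by_contra hne
        exact (hall j (mem_movers.mpr (Ne.symm hne))).not_ge hj
      · rfl
    have h1 : ∃ i ∈ M.movers z, M.utility i z.2 < M.utility i z.1 := ⟨i, hi, hall i hi⟩
    have h2 : ¬ ∃ i ∈ M.movers (M.settle z),
        M.utility i (M.settle z).2 < M.utility i (M.settle z).1 := by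
      rintro ⟨j, hj, hlt⟩
      rw [heq] at hj
      simp only [settle, hbest] at hlt
      exact lt_asymm hlt (hall j hj)
    unfold unrest
    rw [if_pos h1, if_neg h2, heq]
    omega
  · have := Finset.card_lt_card hlt
    unfold unrest
    split_ifs <;> omega

theorem settle_of_eq {z : M.Profile × M.Profile} (hz : z.1 = z.2) : M.settle z = z := by
  obtain ⟨x, y⟩ := z
  obtain rfl : x = y := hz
  ext1
  · rfl
  · funext i
    simp [settle, best, moreSuccessful]

/-- A drop by one is at least the fraction `1 / (2 * M.N + 1)` of a quantity bounded by `2 * M.N +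
1`; this multiplicative form survives taking expectations. -/
theorem unrest_settle_le (z : M.Profile × M.Profile) :
    (M.unrest (M.settle z) : ℝ) ≤ (1 - 1 / (2 * M.N + 1 : ℝ)) * M.unrest z := by
  have hpos : (0 : ℝ) < 2 * M.N + 1 := by positivity
  by_cases hz : z.1 = z.2
  · simp [settle_of_eq hz, unrest_eq_zero.mpr hz]
  · have h1 : (M.unrest (M.settle z) : ℝ) + 1 ≤ M.unrest z := by
      exact_mod_cast unrest_settle_lt hz
    have h2 : (M.unrest z : ℝ) ≤ 2 * M.N + 1 := by exact_mod_cast unrest_le z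
    have h3 : 1 / (2 * M.N + 1 : ℝ) * M.unrest z ≤ 1 := by
      rw [one_div, inv_mul_le_iff₀ hpos]
      linarith
    linarith

theorem unrest_settle_iterate (n : ℕ) (z : M.Profile × M.Profile) :
    M.unrest (M.settle^[n] z) ≤ M.unrest z - n := by
  induction n with
  | zero => simp
  | succ n ih =>
    rw [Function.iterate_succ_apply']
    by_cases hz : (M.settle^[n] z).1 = (M.settle^[n] z).2
    · rw [settle_of_eq hz, unrest_eq_zero.mpr hz]
      omega
    · have := unrest_settle_lt hz
      omega

variable (M) in
/-- The joint action at which the dynamics without exploration comes to rest. -/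
noncomputable def restPoint (z : M.Profile × M.Profile) : M.Profile :=
  (M.settle^[2 * M.N + 1] z).2

theorem restPoint_of_eq {z : M.Profile × M.Profile} (hz : z.1 = z.2) : M.restPoint z = z.2 := by
  rw [restPoint, Function.iterate_fixed (settle_of_eq hz)]

/-- The number of iterations in `restPoint` exhausts the maximal unrest, so a further step changes
nothing. Hence only exploration can move the rest point. -/
theorem restPoint_settle (z : M.Profile × M.Profile) :
    M.restPoint (M.settle z) = M.restPoint z := by
  have h : (M.settle^[2 * M.N + 1] z).1 = (M.settle^[2 * M.N + 1] z).2 := by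
    rw [← unrest_eq_zero]
    have := unrest_settle_iterate (2 * M.N + 1) z
    have := unrest_le z
    omega
  rw [restPoint, restPoint, ← Function.iterate_succ_apply, Function.iterate_succ_apply',
    settle_of_eq h]

theorem settle_update_of_le {s : M.Profile} {i : Fin M.N} {x : M.Action}
    (h : M.utility i s ≤ M.utility i (Function.update s i x)) :
    M.settle (s, Function.update s i x) = (Function.update s i x, Function.update s i x) := by
  unfold settle
  congr 1
  funext j
  by_cases hj : j = i
  · subst hj
    simp [best, moreSuccessful, h]
  · simp [best, moreSuccessful, hj]

theorem restPoint_update_of_le {s : M.Profile} {i : Fin M.N} {x : M.Action}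
    (h : M.utility i s ≤ M.utility i (Function.update s i x)) :
    M.restPoint (s, Function.update s i x) = Function.update s i x := by
  rw [← restPoint_settle, settle_update_of_le h, restPoint_of_eq rfl]

theorem restPoint_update_of_lt {s : M.Profile} {i : Fin M.N} {x : M.Action}
    (h : M.utility i (Function.update s i x) < M.utility i s) :
    M.restPoint (s, Function.update s i x) = s := by
  have h1 : M.settle (s, Function.update s i x) = (Function.update s i x, s) := by
    unfold settle
    congr 1
    funext j
    by_cases hj : j = i
    · subst hj
      simp [best, moreSuccessful, h]
    · simp [best, moreSuccessful, hj]
  -- After the swap, going back to `s i` is itself an improving deviation, so the second step fixes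
  -- `s`.
  have h2 := settle_update_of_le (s := Function.update s i x) (i := i) (x := s i)
    (by simpa using h.le)
  simp only [Function.update_idem, Function.update_eq_self] at h2
  rw [← restPoint_settle, h1, ← restPoint_settle, h2, restPoint_of_eq rfl]

/-! ### Improvement steps -/

variable (M) in
/-- `s'` arises from `s` by a feasible deviation of one agent that does not lower its utility. -/
def Improves (s s' : M.Profile) : Prop :=
  ∃ i, ∃ x ∈ M.feasible (s i).1,
    M.utility i s ≤ M.utility i (Function.update s i x) ∧ s' = Function.update s i x

variable (M) in
/-- The joint actions from which improvement steps lead to equilibria only. -/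
def Stable (s : M.Profile) : Prop :=
  ∀ s', Relation.ReflTransGen M.Improves s s' → s' ∈ M.equilibria

theorem Stable.mem_equilibria {s : M.Profile} (hs : M.Stable s) : s ∈ M.equilibria :=
  hs s .refl

theorem Stable.of_improves {s s' : M.Profile} (hs : M.Stable s) (h : M.Improves s s') :
    M.Stable s' :=
  fun _ h' => hs _ (.head h h')

theorem potential_le_of_reaches {s s' : M.Profile} (h : Relation.ReflTransGen M.Improves s s') :
    M.potential s ≤ M.potential s' := by
  induction h with
  | refl => exact le_rfl
  | @tail b _ _ h ih =>
    obtain ⟨i, x, -, hu, rfl⟩ := h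
    have := M.utility_update_sub i b x
    linarith

/-- Take a potential maximiser among the profiles reachable from `s`. Everything reachable from it
has the same maximal potential, so a strictly profitable deviation would exceed the maximum. -/
theorem exists_reaches_stable (s : M.Profile) :
    ∃ s', Relation.ReflTransGen M.Improves s s' ∧ M.Stable s' := by
  classical
  obtain ⟨m, hm, hmax⟩ := Finset.exists_max_image
    (Finset.univ.filter fun s' => Relation.ReflTransGen M.Improves s s') M.potential
    ⟨s, by simp [Relation.ReflTransGen.refl]⟩
  simp only [Finset.mem_filter, Finset.mem_univ, true_and] at hm hmax
  refine ⟨m, hm, fun s' hs' i x hx => ?_⟩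
  by_contra! hlt
  have h1 : M.Improves s' (Function.update s' i x) := ⟨i, x, hx, hlt.le, rfl⟩
  have h2 := hmax _ ((hm.trans hs').tail h1)
  have h3 := potential_le_of_reaches hs'
  have h4 := M.utility_update_sub i s' x
  linarith

variable (M) in
/-- `n` improvement steps lead from `s` to some stable joint action. -/
def StableWithin : ℕ → M.Profile → Prop
  | 0, s => M.Stable s
  | n + 1, s => ∃ s', M.Improves s s' ∧ StableWithin n s'

theorem exists_stableWithin (s : M.Profile) : ∃ n, M.StableWithin n s := by
  obtain ⟨s', h, hs'⟩ := exists_reaches_stable s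
  induction h using Relation.ReflTransGen.head_induction_on with
  | refl => exact ⟨0, hs'⟩
  | head h _ ih => exact ih.imp' Nat.succ fun n hn => ⟨_, h, hn⟩

open scoped Classical in
variable (M) in
/-- The least number of improvement steps from `s` to a stable joint action. -/
noncomputable def stableDist (s : M.Profile) : ℕ :=
  Nat.find (exists_stableWithin s)

theorem stableDist_eq_zero {s : M.Profile} : M.stableDist s = 0 ↔ M.Stable s := by
  classical
  simp [stableDist, Nat.find_eq_zero, StableWithin]

theorem exists_improves_stableDist {s : M.Profile} (hs : ¬ M.Stable s) :
    ∃ s', M.Improves s s' ∧ M.stableDist s' + 1 ≤ M.stableDist s := by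
  classical
  obtain ⟨n, hn⟩ := Nat.exists_eq_succ_of_ne_zero (mt stableDist_eq_zero.mp hs)
  have h : M.StableWithin (M.stableDist s) s := Nat.find_spec (exists_stableWithin s)
  rw [hn] at h
  obtain ⟨s', h1, h2⟩ := h
  refine ⟨s', h1, ?_⟩
  have : M.stableDist s' ≤ n := Nat.find_min' _ h2
  omega

end Model

end Coverage

namespace Coverage

namespace Model

variable {M : Model}

/-! ### Bounds on the transition probabilities -/

section Step

variable {e : ℝ}

theorem agentProb_best (x y : M.Profile) (i : Fin M.N) :
    M.agentProb e x y i (M.best (x, y) i) = 1 - e := by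
  simp [agentProb, best]

theorem agentProb_nonneg (h0 : 0 ≤ e) (h1 : e ≤ 1) (x y : M.Profile) (i : Fin M.N)
    (w : M.Action) : 0 ≤ M.agentProb e x y i w := by
  have : 0 ≤ 1 - e := by linarith
  unfold agentProb
  positivity

theorem agentProb_eq_zero {x y : M.Profile} {i : Fin M.N} {w : M.Action}
    (hw : w ≠ M.best (x, y) i) (hf : w ∉ M.feasible (y i).1) : M.agentProb e x y i w = 0 := by
  have hw' : w ≠ M.moreSuccessful x y i := hw
  simp [agentProb, hw', hf]

theorem agentProb_le (h0 : 0 ≤ e) {x y : M.Profile} {i : Fin M.N} {w : M.Action}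
    (hw : w ≠ M.best (x, y) i) : M.agentProb e x y i w ≤ e := by
  classical
  have hw' : w ≠ M.moreSuccessful x y i := hw
  have h : (if w ∈ (M.feasible (y i).1).erase (M.moreSuccessful x y i) then
      1 / (((M.feasible (y i).1).erase (M.moreSuccessful x y i)).card : ℝ) else 0) ≤ 1 := by
    split_ifs
    · exact (one_div _).trans_le (Nat.cast_inv_le_one _)
    · exact zero_le_one
  simpa [agentProb, hw'] using mul_le_mul_of_nonneg_left h h0

theorem le_agentProb (h0 : 0 ≤ e) {x y : M.Profile} {i : Fin M.N} {w : M.Action}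
    (hw : w ≠ M.best (x, y) i) (hf : w ∈ M.feasible (y i).1) :
    e / Fintype.card M.Action ≤ M.agentProb e x y i w := by
  classical
  have hw' : w ≠ M.moreSuccessful x y i := hw
  have hS : w ∈ (M.feasible (y i).1).erase (M.moreSuccessful x y i) :=
    Finset.mem_erase.mpr ⟨hw', hf⟩
  have h1 : (0 : ℝ) < ((M.feasible (y i).1).erase (M.moreSuccessful x y i)).card := by
    exact_mod_cast Finset.card_pos.mpr ⟨w, hS⟩
  have h2 : (((M.feasible (y i).1).erase (M.moreSuccessful x y i)).card : ℝ) ≤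
      Fintype.card M.Action := by
    exact_mod_cast Finset.card_le_univ _
  unfold agentProb
  simp only [if_neg hw', if_pos hS, mul_zero, zero_add, div_eq_mul_one_div e]
  exact mul_le_mul_of_nonneg_left (one_div_le_one_div_of_le h1 h2) h0

theorem sum_agentProb_le_one (h0 : 0 ≤ e) (x y : M.Profile) (i : Fin M.N) :
    ∑ w, M.agentProb e x y i w ≤ 1 := by
  classical
  unfold agentProb
  simp only [Finset.sum_add_distrib, ← Finset.mul_sum, Finset.sum_ite_eq', Finset.mem_univ,
    if_true, Finset.sum_ite_mem, Finset.univ_inter, Finset.sum_const, nsmul_eq_mul]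
  -- The quotient is `0` if the agent has no alternative feasible action, so only an inequality is
  -- available.
  have h := div_self_le_one
    (((M.feasible (y i).1).erase (M.moreSuccessful x y i)).card : ℝ)
  rw [← mul_one_div] at h
  nlinarith [mul_le_mul_of_nonneg_left h h0]

theorem agentProb_le_one (h0 : 0 ≤ e) (h1 : e ≤ 1) (x y : M.Profile) (i : Fin M.N)
    (w : M.Action) : M.agentProb e x y i w ≤ 1 :=
  (Finset.single_le_sum (fun w _ => agentProb_nonneg h0 h1 x y i w) (Finset.mem_univ w)).trans
    (sum_agentProb_le_one h0 x y i)

theorem stepProb_nonneg (h0 : 0 ≤ e) (h1 : e ≤ 1) (x y w : M.Profile) :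
    0 ≤ M.stepProb e x y w :=
  Finset.prod_nonneg fun i _ => agentProb_nonneg h0 h1 x y i (w i)

theorem stepProb_le_one (h0 : 0 ≤ e) (h1 : e ≤ 1) (x y w : M.Profile) :
    M.stepProb e x y w ≤ 1 :=
  Finset.prod_le_one (fun i _ => agentProb_nonneg h0 h1 x y i (w i))
    fun i _ => agentProb_le_one h0 h1 x y i (w i)

theorem sum_stepProb_le_one (h0 : 0 ≤ e) (h1 : e ≤ 1) (x y : M.Profile) :
    ∑ w, M.stepProb e x y w ≤ 1 := by
  classical
  unfold stepProb
  rw [← Fintype.prod_sum fun i w => M.agentProb e x y i w]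
  exact Finset.prod_le_one
    (fun i _ => Finset.sum_nonneg fun w _ => agentProb_nonneg h0 h1 x y i w)
    fun i _ => sum_agentProb_le_one h0 x y i

theorem stepProb_best (x y : M.Profile) :
    M.stepProb e x y (M.best (x, y)) = (1 - e) ^ M.N := by
  simp [stepProb, agentProb_best]

theorem stepProb_le_of_ne (h0 : 0 ≤ e) (h1 : e ≤ 1) {x y w : M.Profile}
    (hw : w ≠ M.best (x, y)) : M.stepProb e x y w ≤ e := by
  classical
  obtain ⟨i, hi⟩ := Function.ne_iff.mp hw
  rw [stepProb, ← Finset.mul_prod_erase _ _ (Finset.mem_univ i)]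
  calc _ ≤ e * 1 := by
        refine mul_le_mul (agentProb_le h0 hi) ?_ ?_ h0
        · exact Finset.prod_le_one (fun j _ => agentProb_nonneg h0 h1 x y j (w j))
            fun j _ => agentProb_le_one h0 h1 x y j (w j)
        · exact Finset.prod_nonneg fun j _ => agentProb_nonneg h0 h1 x y j (w j)
    _ = e := mul_one e

theorem stepProb_le_sq (h0 : 0 ≤ e) (h1 : e ≤ 1) {x y w : M.Profile} {i j : Fin M.N}
    (hij : i ≠ j) (hi : w i ≠ M.best (x, y) i) (hj : w j ≠ M.best (x, y) j) :
    M.stepProb e x y w ≤ e ^ 2 := by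
  classical
  rw [stepProb, ← Finset.mul_prod_erase _ _ (Finset.mem_univ i),
    ← Finset.mul_prod_erase _ _ (Finset.mem_erase.mpr ⟨hij.symm, Finset.mem_univ j⟩)]
  have hnn : 0 ≤ ∏ k ∈ (Finset.univ.erase i).erase j, M.agentProb e x y k (w k) :=
    Finset.prod_nonneg fun k _ => agentProb_nonneg h0 h1 x y k (w k)
  calc _ ≤ e * (e * 1) := by
        refine mul_le_mul (agentProb_le h0 hi) ?_
          (mul_nonneg (agentProb_nonneg h0 h1 x y j (w j)) hnn) h0
        refine mul_le_mul (agentProb_le h0 hj) ?_ hnn h0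
        exact Finset.prod_le_one (fun k _ => agentProb_nonneg h0 h1 x y k (w k))
          fun k _ => agentProb_le_one h0 h1 x y k (w k)
    _ = e ^ 2 := by ring

theorem best_self (s : M.Profile) : M.best (s, s) = s := by
  funext i
  simp [best, moreSuccessful]

theorem le_stepProb_update (h0 : 0 ≤ e) (h1 : e ≤ 1) {s : M.Profile} {i : Fin M.N}
    {x : M.Action} (hx : x ≠ s i) (hf : x ∈ M.feasible (s i).1) :
    e / Fintype.card M.Action * (1 - e) ^ M.N ≤
      M.stepProb e s s (Function.update s i x) := by
  classical
  have hprod : ∏ j ∈ Finset.univ.erase i, M.agentProb e s s j (Function.update s i x j) =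
      (1 - e) ^ (M.N - 1) := by
    have h : ∀ j ∈ Finset.univ.erase i,
        M.agentProb e s s j (Function.update s i x j) = 1 - e := fun j hj => by
      rw [Function.update_of_ne (Finset.ne_of_mem_erase hj)]
      simpa only [best_self] using agentProb_best (e := e) s s j
    rw [Finset.prod_congr rfl h]
    simp
  rw [stepProb, ← Finset.mul_prod_erase _ _ (Finset.mem_univ i), hprod, Function.update_self]
  -- The weaker exponent `M.N` matches the probability that nobody explores.
  have hle : (1 - e) ^ M.N ≤ (1 - e) ^ (M.N - 1) :=
    pow_le_pow_of_le_one (by linarith) (by linarith) (Nat.sub_le _ _)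
  refine mul_le_mul (le_agentProb h0 ?_ hf) hle (pow_nonneg (by linarith) _)
    (agentProb_nonneg h0 h1 _ _ _ _)
  rwa [best_self]

/-- Each profile other than `best` requires an explorer and so has probability at most `e`. -/
theorem sum_stepProb_mul_le (h0 : 0 ≤ e) (h1 : e ≤ 1) (x y : M.Profile) {f : M.Profile → ℝ}
    {B : ℝ} (hf0 : ∀ w, 0 ≤ f w) (hfB : ∀ w, f w ≤ B) :
    ∑ w, M.stepProb e x y w * f w ≤ f (M.best (x, y)) + Fintype.card M.Profile * B * e := by
  classical
  have hB : 0 ≤ B := (hf0 x).trans (hfB x)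
  calc ∑ w, M.stepProb e x y w * f w
      ≤ ∑ w, ((if w = M.best (x, y) then f w else 0) + B * e) := by
        refine Finset.sum_le_sum fun w _ => ?_
        split_ifs with hw
        · have := mul_le_mul_of_nonneg_right (stepProb_le_one h0 h1 x y w) (hf0 w)
          nlinarith [mul_nonneg hB h0]
        · have := mul_le_mul (stepProb_le_of_ne h0 h1 hw) (hfB w) (hf0 w) h0
          linarith
    _ = _ := by
        rw [Finset.sum_add_distrib, Finset.sum_ite_eq' Finset.univ]
        simp only [Finset.mem_univ, if_true, Finset.sum_const, Finset.card_univ, nsmul_eq_mul]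
        ring

theorem sum_stepProb_mul_unrest_le (h0 : 0 ≤ e) (h1 : e ≤ 1) (x y : M.Profile) :
    ∑ w, M.stepProb e x y w * (M.unrest (y, w) : ℝ) ≤
      (1 - 1 / (2 * M.N + 1 : ℝ)) * M.unrest (x, y) +
        Fintype.card M.Profile * (2 * M.N + 1) * e := by
  refine (sum_stepProb_mul_le h0 h1 x y (f := fun w => (M.unrest (y, w) : ℝ))
    (B := 2 * M.N + 1) (fun w => Nat.cast_nonneg _)
    fun w => by exact_mod_cast unrest_le _).trans ?_
  have := unrest_settle_le (x, y)
  simp only [settle] at this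
  linarith

end Step

/-! ### The Lyapunov function -/

variable (M) in
/-- The basis of the Lyapunov function. -/
noncomputable def decay : ℝ := 1 / (4 * M.N * Fintype.card M.Action)

variable (M) in
/-- The Lyapunov function of the learning dynamics: it vanishes when the dynamics without
exploration come to rest at a stable joint action. -/
noncomputable def lyapunov (z : M.Profile × M.Profile) : ℝ :=
  1 - M.decay ^ M.stableDist (M.restPoint z)

variable (M) in
/-- A lower bound for the drift of the Lyapunov function towards stable joint actions. -/
noncomputable def drift : ℝ := M.decay ^ Finset.univ.sup M.stableDist

theorem card_action_pos : 0 < Fintype.card M.Action := by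
  have : Nonempty M.Q := M.connected.nonempty
  have : Nonempty M.C := M.C_nonempty.to_subtype
  exact Fintype.card_pos

theorem decay_pos : 0 < M.decay := by
  have h1 := M.N_pos
  have h2 := card_action_pos (M := M)
  unfold decay
  positivity

theorem decay_le : M.decay ≤ 1 / 4 := by
  have h1 : (1 : ℝ) ≤ M.N := by exact_mod_cast M.N_pos
  have h2 : (1 : ℝ) ≤ Fintype.card M.Action := by exact_mod_cast card_action_pos
  unfold decay
  refine one_div_le_one_div_of_le (by norm_num) ?_
  nlinarith

theorem lyapunov_le_one (z : M.Profile × M.Profile) : M.lyapunov z ≤ 1 := by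
  have := pow_pos (decay_pos (M := M)) (M.stableDist (M.restPoint z))
  unfold lyapunov
  linarith

theorem lyapunov_nonneg (z : M.Profile × M.Profile) : 0 ≤ M.lyapunov z :=
  sub_nonneg.mpr (pow_le_one₀ decay_pos.le (decay_le.trans (by norm_num)))

theorem lyapunov_eq_zero {z : M.Profile × M.Profile} (h : M.Stable (M.restPoint z)) :
    M.lyapunov z = 0 := by
  simp [lyapunov, stableDist_eq_zero.mpr h]

theorem half_le_lyapunov {z : M.Profile × M.Profile} (h : ¬ M.Stable (M.restPoint z)) :
    1 / 2 ≤ M.lyapunov z := by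
  have := pow_le_of_le_one decay_pos.le (decay_le (M := M) |>.trans (by norm_num))
    (mt stableDist_eq_zero.mp h)
  have := decay_le (M := M)
  unfold lyapunov
  linarith

theorem drift_pos : 0 < M.drift := pow_pos decay_pos _

theorem drift_le_one : M.drift ≤ 1 :=
  pow_le_one₀ decay_pos.le (decay_le.trans (by norm_num))

theorem drift_le (s : M.Profile) : M.drift ≤ M.decay ^ M.stableDist s :=
  pow_le_pow_of_le_one decay_pos.le (decay_le.trans (by norm_num))
    (Finset.le_sup (f := M.stableDist) (Finset.mem_univ s))

section Step

variable {e : ℝ}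

/-- Two explorers cost `e ^ 2`. A lone explorer either reverts or makes a weak improvement, and both
lead to a stable rest point; infeasible moves have probability `0`. -/
theorem sum_stepProb_mul_lyapunov_le_of_stable (h0 : 0 ≤ e) (h1 : e ≤ 1) {s : M.Profile}
    (hs : M.Stable s) :
    ∑ w, M.stepProb e s s w * M.lyapunov (s, w) ≤ Fintype.card M.Profile * e ^ 2 := by
  classical
  calc ∑ w, M.stepProb e s s w * M.lyapunov (s, w) ≤ ∑ w : M.Profile, e ^ 2 := by
        refine Finset.sum_le_sum fun w _ => ?_
        by_cases hw : w = s
        · subst hw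
          rw [lyapunov_eq_zero (by rwa [restPoint_of_eq rfl]), mul_zero]
          positivity
        obtain ⟨i, hi⟩ := Function.ne_iff.mp hw
        by_cases hj : ∃ j, i ≠ j ∧ w j ≠ s j
        · obtain ⟨j, hij, hj⟩ := hj
          have := stepProb_le_sq h0 h1 (x := s) (y := s) hij (by rwa [best_self])
            (by rwa [best_self])
          exact (mul_le_of_le_one_right (stepProb_nonneg h0 h1 s s w)
            (lyapunov_le_one _)).trans this
        push Not at hj
        obtain ⟨x, rfl⟩ : ∃ x, w = Function.update s i x := by
          refine ⟨w i, funext fun j => ?_⟩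
          by_cases hij : j = i
          · subst hij; simp
          · simp [hij, hj j (Ne.symm hij)]
        rw [Function.update_self] at hi
        by_cases hf : x ∈ M.feasible (s i).1
        · rw [lyapunov_eq_zero, mul_zero]
          · positivity
          · rcases le_or_gt (M.utility i s) (M.utility i (Function.update s i x)) with h | h
            · rw [restPoint_update_of_le h]
              exact hs.of_improves ⟨i, x, hf, h, rfl⟩
            · rwa [restPoint_update_of_lt h]
        · rw [stepProb, Finset.prod_eq_zero (Finset.mem_univ i), zero_mul]
          · positivity
          · rw [Function.update_self]
            exact agentProb_eq_zero (by rwa [best_self]) hf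
    _ = _ := by simp

/-- Only two targets are kept: `s` itself, and one improvement that shortens the distance to
stability. Staying loses at most `N * e * η ^ stableDist s`, and the improvement gains at least
twice that. -/
theorem sum_stepProb_mul_lyapunov_le_of_not_stable (h0 : 0 ≤ e) (h1 : e ≤ 1)
    (he : 1 / 2 ≤ (1 - e) ^ M.N) {s : M.Profile} (hs : ¬ M.Stable s) :
    ∑ w, M.stepProb e s s w * M.lyapunov (s, w) ≤ M.lyapunov (s, s) - M.drift * e := by
  classical
  obtain ⟨s', ⟨i, x, hf, hu, rfl⟩, hd⟩ := exists_improves_stableDist hs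
  have hx : x ≠ s i := by
    rintro rfl
    rw [Function.update_eq_self] at hd
    omega
  have hne : s ≠ Function.update s i x := fun h => hx (by
    have := congrFun h i
    rw [Function.update_self] at this
    exact this.symm)
  set η := M.decay with hη
  have hη0 : 0 < η := decay_pos
  have hη1 : η ≤ 1 := decay_le.trans (by norm_num)
  have hsum : (1 - e) ^ M.N * η ^ M.stableDist s +
      e / Fintype.card M.Action * (1 - e) ^ M.N * η ^ M.stableDist (Function.update s i x) ≤
        ∑ w, M.stepProb e s s w * η ^ M.stableDist (M.restPoint (s, w)) := by
    refine le_trans ?_ (Finset.sum_le_sum_of_subset_of_nonneg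
      (Finset.subset_univ {s, Function.update s i x})
      fun w _ _ => mul_nonneg (stepProb_nonneg h0 h1 s s w) (pow_nonneg hη0.le _))
    rw [Finset.sum_pair hne, restPoint_of_eq rfl, restPoint_update_of_le hu]
    have h2 := stepProb_best (e := e) s s
    rw [best_self] at h2
    rw [h2]
    exact add_le_add le_rfl (mul_le_mul_of_nonneg_right (le_stepProb_update h0 h1 hx hf)
      (pow_nonneg hη0.le _))
  have hpow : η ^ M.stableDist s ≤ η * η ^ M.stableDist (Function.update s i x) := by
    rw [← pow_succ']
    exact pow_le_pow_of_le_one hη0.le hη1 hd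
  have hN : (1 : ℝ) ≤ M.N := by exact_mod_cast M.N_pos
  have hA : (0 : ℝ) < Fintype.card M.Action := by exact_mod_cast card_action_pos
  -- This fixes the value of `decay`: of the factor `4`, one half is lost to `(1 - e) ^ M.N ≥ 1 /
  -- 2`, which leaves the gain of `2 * N * e`.
  have hcard : e / Fintype.card M.Action = 4 * M.N * e * η := by
    rw [hη, decay]
    field_simp
  have hbern : 1 - M.N * e ≤ (1 - e) ^ M.N := by
    have := one_add_mul_le_pow (a := -e) (by linarith) M.N
    rw [← sub_eq_add_neg] at this
    linarith
  have hU : 0 ≤ η ^ M.stableDist s := pow_nonneg hη0.le _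
  have hNe : 0 ≤ M.N * e := mul_nonneg (by linarith) h0
  have hterm1 := mul_le_mul_of_nonneg_right hbern hU
  have hterm2 : 2 * (M.N * e) * η ^ M.stableDist s ≤ e / Fintype.card M.Action *
      (1 - e) ^ M.N * η ^ M.stableDist (Function.update s i x) := by
    calc 2 * (M.N * e) * η ^ M.stableDist s
        ≤ 2 * (M.N * e) * (η * η ^ M.stableDist (Function.update s i x)) :=
          mul_le_mul_of_nonneg_left hpow (by linarith)
      _ = (4 * (M.N * e) * η * η ^ M.stableDist (Function.update s i x)) * (1 / 2) := by ring
      _ ≤ (4 * (M.N * e) * η * η ^ M.stableDist (Function.update s i x)) * (1 - e) ^ M.N :=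
          mul_le_mul_of_nonneg_left he (by positivity)
      _ = _ := by rw [hcard]; ring
  have hdr : M.drift * e ≤ M.N * e * η ^ M.stableDist s := by
    have h3 : M.drift * e ≤ η ^ M.stableDist s * e :=
      mul_le_mul_of_nonneg_right (drift_le s) h0
    have h4 : 0 ≤ (M.N - 1) * (η ^ M.stableDist s * e) :=
      mul_nonneg (by linarith) (mul_nonneg hU h0)
    linarith
  have htot := sum_stepProb_le_one h0 h1 s s
  simp only [lyapunov, mul_sub, mul_one, Finset.sum_sub_distrib]
  rw [restPoint_of_eq rfl]
  linarith

theorem sum_stepProb_mul_lyapunov_le (h0 : 0 ≤ e) (h1 : e ≤ 1)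
    (he : 1 / 2 ≤ (1 - e) ^ M.N) (x y : M.Profile) :
    ∑ w, M.stepProb e x y w * M.lyapunov (y, w) ≤
      (1 - M.drift * e) * M.lyapunov (x, y) +
        (Fintype.card M.Profile + 1) * e * (e + M.unrest (x, y)) := by
  have hK : (0 : ℝ) ≤ Fintype.card M.Profile := Nat.cast_nonneg _
  have hV0 := lyapunov_nonneg (x, y)
  have hV1 := lyapunov_le_one (x, y)
  have hde : 0 ≤ M.drift * e := mul_nonneg drift_pos.le h0
  have hdV : M.drift * e * M.lyapunov (x, y) ≤ M.drift * e := mul_le_of_le_one_right hde hV1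
  by_cases hxy : x = y
  · subst hxy
    have hk : M.unrest (x, x) = 0 := unrest_eq_zero.mpr rfl
    rw [hk, Nat.cast_zero, add_zero]
    by_cases hs : M.Stable x
    · have := sum_stepProb_mul_lyapunov_le_of_stable h0 h1 hs
      rw [lyapunov_eq_zero (z := (x, x)) (by rwa [restPoint_of_eq rfl])]
      nlinarith
    · have := sum_stepProb_mul_lyapunov_le_of_not_stable h0 h1 he hs
      have : 0 ≤ (Fintype.card M.Profile + 1) * e * e := by positivity
      linarith
  · have hk : (1 : ℝ) ≤ M.unrest (x, y) := by
      exact_mod_cast Nat.one_le_iff_ne_zero.mpr (mt unrest_eq_zero.mp hxy)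
    have h := sum_stepProb_mul_le h0 h1 x y (f := fun w => M.lyapunov (y, w)) (B := 1)
      (fun w => lyapunov_nonneg _) fun w => lyapunov_le_one _
    have hset : M.lyapunov (y, M.best (x, y)) = M.lyapunov (x, y) := by
      rw [lyapunov, lyapunov, ← restPoint_settle (x, y), settle]
    simp only [hset] at h
    -- Away from the diagonal there is no useful drift, but the unrest is at least `1`, so the error
    -- term absorbs both the exploration cost and the claimed drift.
    have hd : M.drift * e ≤ e := mul_le_of_le_one_left h0 drift_le_one
    have h5 : (Fintype.card M.Profile + 1) * e * 1 ≤
        (Fintype.card M.Profile + 1) * e * (e + M.unrest (x, y)) :=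
      mul_le_mul_of_nonneg_left (by linarith) (by positivity)
    linarith

end Step

end Model

end Coverage

/-! ### Recursions of real numbers -/

/-- A nonnegative sequence that is contracted towards a null sequence, with contraction rates that
are not summable, tends to zero. -/
theorem tendsto_zero_of_contraction {v a b : ℕ → ℝ} (hv : ∀ t, 0 ≤ v t)
    (ha : Tendsto (fun n => ∑ t ∈ Finset.range n, a t) atTop atTop)
    (hb : Tendsto b atTop (𝓝 0))
    (h : ∀ᶠ t in atTop, 0 ≤ a t ∧ a t ≤ 1 ∧ v (t + 1) ≤ (1 - a t) * v t + a t * b t) :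
    Tendsto v atTop (𝓝 0) := by
  rw [Metric.tendsto_atTop']
  intro δ hδ
  obtain ⟨T, hT⟩ := eventually_atTop.mp (h.and (hb.eventually_le_const (half_pos hδ)))
  -- Iterating `1 - a ≤ exp (-a)` damps the initial value, while the inputs `b t ≤ δ / 2` never push
  -- past `δ / 2`.
  have hbound : ∀ n, v (T + n) ≤
      δ / 2 + Real.exp (∑ t ∈ Finset.range T, a t - ∑ t ∈ Finset.range (T + n), a t) * v T := by
    intro n
    induction n with
    | zero => simpa using (half_pos hδ).le
    | succ n ih =>
      obtain ⟨⟨h0, h1, h2⟩, h3⟩ := hT (T + n) (Nat.le_add_right _ _)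
      rw [← add_assoc, Finset.sum_range_succ, ← sub_sub, sub_eq_add_neg _ (a (T + n)),
        Real.exp_add]
      set E := Real.exp (∑ t ∈ Finset.range T, a t - ∑ t ∈ Finset.range (T + n), a t)
      have h4 : 1 - a (T + n) ≤ Real.exp (-a (T + n)) := by
        linarith [Real.add_one_le_exp (-a (T + n))]
      have h5 := mul_le_mul_of_nonneg_left ih (sub_nonneg.mpr h1)
      have h6 := mul_le_mul_of_nonneg_left h3 h0
      have h7 := mul_le_mul_of_nonneg_right h4 (mul_nonneg (Real.exp_pos _).le (hv T) : 0 ≤ E * v T)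
      linarith
  have hexp : Tendsto (fun n =>
      Real.exp (∑ t ∈ Finset.range T, a t - ∑ t ∈ Finset.range n, a t) * v T)
      atTop (𝓝 0) := by
    have h1 : Tendsto (fun n => ∑ t ∈ Finset.range T, a t - ∑ t ∈ Finset.range n, a t)
        atTop atBot := by
      simp only [sub_eq_add_neg]
      exact tendsto_atBot_add_const_left _ _ (tendsto_neg_atTop_atBot.comp ha)
    simpa using (Real.tendsto_exp_atBot.comp h1).mul_const (v T)
  obtain ⟨S, hS⟩ := eventually_atTop.mp (hexp.eventually_lt_const (half_pos hδ))
  refine ⟨max T S, fun n hn => ?_⟩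
  obtain ⟨k, rfl⟩ := Nat.exists_eq_add_of_le ((le_max_left T S).trans hn.le)
  have h1 := hS _ ((le_max_right T S).trans hn.le)
  have h2 := hbound k
  rw [Real.dist_eq, sub_zero, abs_of_nonneg (hv _)]
  linarith

/-! ### Expectations of finite-valued random variables -/

theorem MeasureTheory.integral_comp_fintype {Ω α : Type*} [MeasurableSpace Ω] {μ : Measure Ω}
    [IsFiniteMeasure μ] [Fintype α] [MeasurableSpace α] [MeasurableSingletonClass α]
    {X : Ω → α} (hX : Measurable X) (f : α → ℝ) :
    ∫ ω, f (X ω) ∂μ = ∑ a, μ.real (X ⁻¹' {a}) * f a := by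
  rw [← integral_map hX.aemeasurable (measurable_of_finite f).aestronglyMeasurable,
    integral_fintype .of_finite]
  refine Finset.sum_congr rfl fun a _ => ?_
  rw [map_measureReal_apply hX (measurableSet_singleton a), smul_eq_mul]

namespace Coverage

namespace Model

variable {M : Model}

/-! ### The exploration rate -/

/-- Positivity makes the rate vanish; the upper bound `1` makes its sum diverge. Nothing else about
the exponent matters. -/
theorem rate_exponent_mem :
    0 < 1 / ((M.N : ℝ) * ((M.D : ℝ) + 1)) ∧ 1 / ((M.N : ℝ) * ((M.D : ℝ) + 1)) ≤ 1 := by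
  have h1 : (1 : ℝ) ≤ M.N := by exact_mod_cast M.N_pos
  have h2 : (0 : ℝ) ≤ M.D := Nat.cast_nonneg _
  have h3 : 1 ≤ (M.N : ℝ) * ((M.D : ℝ) + 1) := by nlinarith
  exact ⟨by positivity, by rw [div_le_one (by linarith)]; exact h3⟩

theorem rate_nonneg (t : ℕ) : 0 ≤ M.rate t :=
  Real.rpow_nonneg (Nat.cast_nonneg _) _

theorem rate_le_one {t : ℕ} (ht : 1 ≤ t) : M.rate t ≤ 1 :=
  Real.rpow_le_one_of_one_le_of_nonpos (by exact_mod_cast ht)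
    (neg_nonpos.mpr rate_exponent_mem.1.le)

theorem tendsto_rate : Tendsto M.rate atTop (𝓝 0) :=
  (tendsto_rpow_neg_atTop rate_exponent_mem.1).comp tendsto_natCast_atTop_atTop

theorem tendsto_sum_rate :
    Tendsto (fun n => ∑ t ∈ Finset.range n, M.rate t) atTop atTop := by
  refine (not_summable_iff_tendsto_nat_atTop_of_nonneg rate_nonneg).mp fun h => ?_
  have := Real.summable_nat_rpow.mp h
  linarith [rate_exponent_mem (M := M).2]

/-! ### Expectations along the learning algorithm -/

section Expectation

instance : MeasurableSingletonClass M.Profile := Pi.instMeasurableSingletonClass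

variable {Ω : Type*} [MeasurableSpace Ω] {μ : Measure Ω} [IsProbabilityMeasure μ]
  {s : ℕ → Ω → M.Profile}

/-- The transition law is given on cylinders of the whole past, so the expectation is decomposed
over the finitely many histories up to time `t`. -/
theorem IsDISCL.integral_succ (hs : M.IsDISCL μ s) {t : ℕ} (ht : 2 ≤ t)
    (f : M.Profile × M.Profile → ℝ) :
    ∫ ω, f (s t ω, s (t + 1) ω) ∂μ =
      ∫ ω, ∑ w, M.stepProb (M.rate t) (s (t - 1) ω) (s t ω) w * f (s t ω, w) ∂μ := by
  classical
  have h0 := M.rate_nonneg t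
  have h1 := M.rate_le_one (t := t) (by omega)
  let H : Ω → (Fin (t + 1) → M.Profile) := fun ω k => s k ω
  let a : Fin (t + 1) := ⟨t - 1, by omega⟩
  let b : Fin (t + 1) := ⟨t, by omega⟩
  have hH : Measurable H := measurable_pi_lambda _ fun k => hs.measurable k
  have hHs : Measurable fun ω => (H ω, s (t + 1) ω) := hH.prodMk (hs.measurable _)
  have key : ∀ (g : Fin (t + 1) → M.Profile) (w : M.Profile),
      μ.real ((fun ω => (H ω, s (t + 1) ω)) ⁻¹' {(g, w)}) =
        μ.real (H ⁻¹' {g}) * M.stepProb (M.rate t) (g a) (g b) w := by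
    intro g w
    -- Any extension of the history beyond time `t` would serve; this one is periodic.
    let h : ℕ → M.Profile := fun k => g (Fin.ofNat (t + 1) k)
    have hval : ∀ (k : ℕ) (hk : k < t + 1), h k = g ⟨k, hk⟩ := fun k hk => by
      simp only [h]
      congr 1
      ext
      simp [Nat.mod_eq_of_lt hk]
    have hset : H ⁻¹' {g} = {ω | ∀ k ≤ t, s k ω = h k} := by
      ext ω
      rw [Set.mem_preimage, Set.mem_singleton_iff, Set.mem_ofPred_eq, funext_iff]
      exact ⟨fun hω k hk => by rw [hval k (by omega)]; exact hω ⟨k, by omega⟩,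
        fun hω k => (hω k (by omega)).trans (hval k k.2)⟩
    have hset' : (fun ω => (H ω, s (t + 1) ω)) ⁻¹' {(g, w)} =
        {ω | (∀ k ≤ t, s k ω = h k) ∧ s (t + 1) ω = w} := by
      ext ω
      have := Set.ext_iff.mp hset ω
      simp only [Set.mem_preimage, Set.mem_singleton_iff, Set.mem_ofPred_eq, Prod.mk.injEq]
        at this ⊢
      rw [this]
    rw [hset, hset', measureReal_def, measureReal_def, hs.update t ht h w, ENNReal.toReal_mul,
      ENNReal.toReal_ofReal (stepProb_nonneg h0 h1 _ _ _), hval (t - 1) (by omega),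
      hval t (by omega)]
  calc ∫ ω, f (s t ω, s (t + 1) ω) ∂μ
      = ∑ p : (Fin (t + 1) → M.Profile) × M.Profile,
          μ.real ((fun ω => (H ω, s (t + 1) ω)) ⁻¹' {p}) * f (p.1 b, p.2) :=
        integral_comp_fintype hHs fun p => f (p.1 b, p.2)
    _ = ∑ g : Fin (t + 1) → M.Profile, μ.real (H ⁻¹' {g}) *
          ∑ w, M.stepProb (M.rate t) (g a) (g b) w * f (g b, w) := by
        rw [Fintype.sum_prod_type]
        refine Finset.sum_congr rfl fun g _ => ?_
        rw [Finset.mul_sum]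
        exact Finset.sum_congr rfl fun w _ => by rw [key, mul_assoc]
    _ = _ := (integral_comp_fintype hH fun g =>
        ∑ w, M.stepProb (M.rate t) (g a) (g b) w * f (g b, w)).symm

theorem IsDISCL.integrable (hs : M.IsDISCL μ s) (f : M.Profile × M.Profile → ℝ) (j k : ℕ) :
    Integrable (fun ω => f (s j ω, s k ω)) μ :=
  (Integrable.of_finite (μ := μ.map fun ω => (s j ω, s k ω)) (f := f)).comp_measurable
    ((hs.measurable j).prodMk (hs.measurable k))

theorem IsDISCL.tendsto_integral_unrest (hs : M.IsDISCL μ s) :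
    Tendsto (fun t => ∫ ω, (M.unrest (s (t - 1) ω, s t ω) : ℝ) ∂μ) atTop (𝓝 0) := by
  have hG : (0 : ℝ) < 2 * M.N + 1 := by positivity
  refine tendsto_zero_of_contraction (a := fun _ => 1 / (2 * M.N + 1 : ℝ))
    (b := fun t => (2 * M.N + 1) * (Fintype.card M.Profile * (2 * M.N + 1)) * M.rate t)
    (fun t => integral_nonneg fun ω => Nat.cast_nonneg _) ?_ ?_ ?_
  · simp only [Finset.sum_const, Finset.card_range, nsmul_eq_mul]
    exact tendsto_natCast_atTop_atTop.atTop_mul_const (by positivity)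
  · simpa using tendsto_rate.const_mul _
  · filter_upwards [eventually_ge_atTop 2] with t ht
    refine ⟨by positivity, ?_, ?_⟩
    · rw [div_le_one hG]
      linarith [(Nat.cast_nonneg M.N : (0 : ℝ) ≤ M.N)]
    · rw [Nat.add_sub_cancel, hs.integral_succ ht fun z => (M.unrest z : ℝ)]
      calc _ ≤ ∫ ω, ((1 - 1 / (2 * M.N + 1 : ℝ)) * M.unrest (s (t - 1) ω, s t ω) +
            Fintype.card M.Profile * (2 * M.N + 1) * M.rate t) ∂μ := by
            refine integral_mono (hs.integrable (fun z =>
              ∑ w, M.stepProb (M.rate t) z.1 z.2 w * (M.unrest (z.2, w) : ℝ)) _ _)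
              (hs.integrable (fun z => (1 - 1 / (2 * M.N + 1 : ℝ)) * M.unrest z +
                Fintype.card M.Profile * (2 * M.N + 1) * M.rate t) _ _) fun ω => ?_
            exact sum_stepProb_mul_unrest_le (M.rate_nonneg t) (M.rate_le_one (by omega)) _ _
        _ = _ := by
            rw [integral_add
              ((hs.integrable (fun z => (M.unrest z : ℝ)) _ _).const_mul _)
              (integrable_const _), integral_const_mul, integral_const]
            simp only [probReal_univ, one_smul]
            field_simp

/-- The error is of the same order in `ε` as the contraction, so what must vanish is their ratio,
which is why the unrest is treated beforehand. -/
theorem IsDISCL.tendsto_integral_lyapunov (hs : M.IsDISCL μ s) :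
    Tendsto (fun t => ∫ ω, M.lyapunov (s (t - 1) ω, s t ω) ∂μ) atTop (𝓝 0) := by
  have hd := drift_pos (M := M)
  refine tendsto_zero_of_contraction (a := fun t => M.drift * M.rate t)
    (b := fun t => (Fintype.card M.Profile + 1) / M.drift *
      (M.rate t + ∫ ω, (M.unrest (s (t - 1) ω, s t ω) : ℝ) ∂μ))
    (fun t => integral_nonneg fun ω => lyapunov_nonneg _) ?_ ?_ ?_
  · simp only [← Finset.mul_sum]
    exact tendsto_sum_rate.const_mul_atTop hd
  · simpa using (tendsto_rate.add hs.tendsto_integral_unrest).const_mul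
      ((Fintype.card M.Profile + 1) / M.drift)
  · have hpow : Tendsto (fun t => (1 - M.rate t) ^ M.N) atTop (𝓝 1) := by
      simpa using (tendsto_rate (M := M).const_sub 1).pow M.N
    filter_upwards [eventually_ge_atTop 2,
      hpow.eventually_const_le (by norm_num : (1 / 2 : ℝ) < 1)] with t ht he
    have h0 := M.rate_nonneg t
    have h1 := M.rate_le_one (t := t) (by omega)
    refine ⟨by positivity, mul_le_one₀ drift_le_one h0 h1, ?_⟩
    rw [Nat.add_sub_cancel, hs.integral_succ ht M.lyapunov]
    calc _ ≤ ∫ ω, ((1 - M.drift * M.rate t) * M.lyapunov (s (t - 1) ω, s t ω) +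
          (Fintype.card M.Profile + 1) * M.rate t *
            (M.rate t + M.unrest (s (t - 1) ω, s t ω))) ∂μ := by
          refine integral_mono (hs.integrable (fun z =>
            ∑ w, M.stepProb (M.rate t) z.1 z.2 w * M.lyapunov (z.2, w)) _ _)
            (hs.integrable (fun z => (1 - M.drift * M.rate t) * M.lyapunov z +
              (Fintype.card M.Profile + 1) * M.rate t * (M.rate t + M.unrest z)) _ _)
            fun ω => ?_
          exact sum_stepProb_mul_lyapunov_le h0 h1 he _ _
      _ = _ := by
          have hi := hs.integrable (fun z => (M.unrest z : ℝ)) (t - 1) t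
          have hi' := (hs.integrable (fun z => M.rate t + (M.unrest z : ℝ)) (t - 1) t).const_mul
            ((Fintype.card M.Profile + 1) * M.rate t)
          rw [integral_add ((hs.integrable M.lyapunov _ _).const_mul _) hi', integral_const_mul, integral_const_mul,
            integral_add (integrable_const _) hi, integral_const]
          simp only [probReal_univ, one_smul]
          field_simp

/-- Outside the target set, either the last two profiles differ and the unrest is at least `1`, or
they agree at an unstable profile and the Lyapunov function is at least `1 / 2`. -/
theorem IsDISCL.measureReal_compl_le (hs : M.IsDISCL μ s) (t : ℕ) :
    μ.real {ω | (s (t - 1) ω, s t ω) ∈ M.diagEquilibria}ᶜ ≤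
      (∫ ω, (M.unrest (s (t - 1) ω, s t ω) : ℝ) ∂μ) +
        2 * ∫ ω, M.lyapunov (s (t - 1) ω, s t ω) ∂μ := by
  have hmeas : MeasurableSet {ω | (s (t - 1) ω, s t ω) ∈ M.diagEquilibria}ᶜ :=
    ((hs.measurable (t - 1)).prodMk (hs.measurable t)
      (Set.toFinite M.diagEquilibria).measurableSet).compl
  have h1 := hs.integrable (fun z => (M.unrest z : ℝ)) (t - 1) t
  have h2 := (hs.integrable M.lyapunov (t - 1) t).const_mul 2
  rw [← integral_const_mul, ← integral_add h1 h2, ← integral_indicator_one hmeas]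
  refine integral_mono ((integrable_const 1).indicator hmeas) (h1.add h2) fun ω => ?_
  have hV := lyapunov_nonneg (s (t - 1) ω, s t ω)
  refine Set.indicator_apply_le' (fun hω => ?_) fun _ => by positivity
  rw [Pi.one_apply]
  by_cases hxy : s (t - 1) ω = s t ω
  · have hns : ¬ M.Stable (M.restPoint (s (t - 1) ω, s t ω)) := by
      rw [restPoint_of_eq hxy]
      exact fun h => hω ⟨s t ω, h.mem_equilibria, by rw [hxy]⟩
    have := half_le_lyapunov hns
    have : (0 : ℝ) ≤ M.unrest (s (t - 1) ω, s t ω) := Nat.cast_nonneg _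
    linarith
  · have : (1 : ℝ) ≤ M.unrest (s (t - 1) ω, s t ω) := by
      exact_mod_cast Nat.one_le_iff_ne_zero.mpr (mt unrest_eq_zero.mp hxy)
    linarith

theorem IsDISCL.tendsto_diagEquilibria (hs : M.IsDISCL μ s) :
    Tendsto (fun t : ℕ => μ {ω | (s (t - 1) ω, s t ω) ∈ M.diagEquilibria}) atTop (𝓝 1) := by
  have hreal : Tendsto (fun t : ℕ => μ.real {ω | (s (t - 1) ω, s t ω) ∈ M.diagEquilibria})
      atTop (𝓝 1) := by
    have hlim : Tendsto (fun t => 1 - ((∫ ω, (M.unrest (s (t - 1) ω, s t ω) : ℝ) ∂μ) +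
        2 * ∫ ω, M.lyapunov (s (t - 1) ω, s t ω) ∂μ)) atTop (𝓝 1) := by
      simpa using (hs.tendsto_integral_unrest.add
        (hs.tendsto_integral_lyapunov.const_mul 2)).const_sub 1
    refine tendsto_of_tendsto_of_tendsto_of_le_of_le hlim tendsto_const_nhds (fun t => ?_)
      fun t => measureReal_le_one
    have hmeas : MeasurableSet {ω | (s (t - 1) ω, s t ω) ∈ M.diagEquilibria} :=
      (hs.measurable (t - 1)).prodMk (hs.measurable t)
        (Set.toFinite M.diagEquilibria).measurableSet
    have h1 := hs.measureReal_compl_le t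
    rw [probReal_compl_eq_one_sub hmeas] at h1
    dsimp only
    linarith
  simpa using ENNReal.tendsto_ofReal hreal

theorem IsDISCL.tendsto_equilibria (hs : M.IsDISCL μ s) :
    Tendsto (fun t : ℕ => μ {ω | s t ω ∈ M.equilibria}) atTop (𝓝 1) := by
  refine tendsto_of_tendsto_of_tendsto_of_le_of_le hs.tendsto_diagEquilibria tendsto_const_nhds
    (fun t => measure_mono ?_) fun t => prob_le_one
  rintro ω ⟨x, hx, h⟩
  rw [Prod.mk.injEq] at h
  rw [Set.mem_ofPred_eq, h.2]
  exact hx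

end Expectation

end Model

end Coverage

theorem theorem1 (M : Coverage.Model) (hM : 1 < M.Q.card * M.C.card)
    {Ω : Type*} [MeasurableSpace Ω] (μ : Measure Ω) [IsProbabilityMeasure μ]
    (s : ℕ → Ω → M.Profile) (hs : M.IsDISCL μ s) :
    Tendsto (fun t : ℕ => μ {ω | (s (t - 1) ω, s t ω) ∈ M.diagEquilibria}) atTop (𝓝 1) ∧
      Tendsto (fun t : ℕ => μ {ω | s t ω ∈ M.equilibria}) atTop (𝓝 1) :=
  ⟨hs.tendsto_diagEquilibria, hs.tendsto_equilibria⟩
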